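/- A finite word $w$ is a $\beta$-power, for a rational number $\beta$, if $w = x^n x'$ for some nonempty word $x$, some integer $n \ge 0$ and some prefix $x'$ of $x$ with $\beta = n + |x'|/|x|$; a $2$-power is called a square. For a real number $\alpha$, an infinite word is $\alpha$-power-free if none of its finite subwords (blocks of consecutive letters) is a $\beta$-power for any rational $\beta \ge \alpha$. Theorem. For every real number $\alpha > 2$ there exists an infinite $\alpha$-power-free binary word $\mathbf{a} = a_0 a_1 a_2 \cdots$ that contains squares beginning at every position, that is, for every $i \ge 0$ there is an $m \ge 1$ such that $a_i a_{i+1} \cdots a_{i+m-1}$ is a square. -/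

import Mathlib

namespace InfWord

/-- The word `w` is a `β`-power: `w = xⁿx'` with `x` nonempty, `x'` a prefix of `x`, and
`β = n + |x'| / |x|`. -/
def IsPower {A : Type*} (w : List A) (β : ℚ) : Prop :=
  ∃ (x x' : List A) (n : ℕ), x ≠ [] ∧ x' <+: x ∧
    w = (List.replicate n x).flatten ++ x' ∧
    β = (n : ℚ) + (x'.length : ℚ) / (x.length : ℚ)

/-- A square is a `2`-power. -/
def IsSquareWord {A : Type*} (w : List A) : Prop :=
  IsPower w 2

/-- The subword `a i, a (i + 1), …, a (i + m - 1)` of length `m` of the infinite word `a` that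
begins at position `i`. -/
def subword {A : Type*} (a : ℕ → A) (i m : ℕ) : List A :=
  (List.range m).map fun k => a (i + k)

/-- For real `α`, the infinite word `a` is `α`-power-free: none of its subwords is a `β`-power
for a rational number `β ≥ α`. -/
def PowerFree {A : Type*} (a : ℕ → A) (α : ℝ) : Prop :=
  ∀ β : ℚ, α ≤ (β : ℝ) → ∀ i m : ℕ, ¬ IsPower (subword a i m) β

/-- Some square begins at position `i` of the infinite word `a`. -/
def HasSquareAt {A : Type*} (a : ℕ → A) (i : ℕ) : Prop :=
  ∃ m : ℕ, IsSquareWord (subword a i m)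

end InfWord

/-! Let `μ` be the Thue–Morse morphism `0 ↦ 01`, `1 ↦ 10`. The witness is the word `w` with
`w 0 = 0` and `w = 0 μˢ(w)`, for large even `s`. As `μˢ(0)` ends in `0`, the prefix
`0 μˢ(0) μˢ(0)` of `w` is an overlap. Applying `μˢ` to an overlap of length `2p + 1` that starts at
position `i` of `w` gives a block of period `2ˢp` with `2ˢ` letters in excess of two periods, hence
overlaps of `w` starting at all positions `2ˢi + 1, …, 2ˢi + 2ˢ`.

Conversely, an overlap in `μ(u)` has even period and comes from a repetition of `u` of half the
period, so an overlap of `w` descends through `μˢ` to an overlap of `w` of smaller period, up to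
the loss of the first letter of `w`. The bound `m + 1 ≤ (2 + 4 / 2ˢ) p` on the length `m` of an
overlap of period `p` passes from the descended overlap to the original one, the slack `1` absorbing
that letter. The descent can only stop at the first letter of `w` followed by a square prefix of
`μˢ(w)`, whose period is at least `2ˢ⁻¹`. -/

namespace InfWord

section Periods

variable {A : Type*}

theorem hasPeriod_of_isPrefix_append {w x : List A} (h : w <+: x ++ w) :
    w.HasPeriod x.length := by
  refine List.hasPeriod_iff_getElem?.2 fun i hi => ?_
  have hshift : (x ++ w)[i + x.length]? = w[i]? := by
    rw [List.getElem?_append_right (Nat.le_add_left _ _), Nat.add_sub_cancel]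
  rw [← hshift, List.prefix_iff_getElem?.1 h (i + x.length) (by omega), List.getElem?_eq_getElem]

theorem isPrefix_drop_mul {w : List A} {p : ℕ} (h : w.HasPeriod p) (n : ℕ) :
    w.drop (n * p) <+: w := by
  induction n with
  | zero => simp
  | succ n ih =>
    have hdrop : (w.drop (n * p)).HasPeriod p := h.infix (List.drop_suffix _ _).isInfix
    rw [add_one_mul, ← List.drop_drop]
    exact (hdrop.drop_prefix p).trans ih

theorem flatten_replicate_take_append_drop {w : List A} {p n : ℕ} (h : w.HasPeriod p)
    (hn : n * p ≤ w.length) :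
    (List.replicate n (w.take p)).flatten ++ w.drop (n * p) = w := by
  induction n with
  | zero => simp
  | succ n ih =>
    rw [add_one_mul] at hn ⊢
    have htake : (w.drop (n * p)).take p = w.take p :=
      ((isPrefix_drop_mul h n).take p).eq_of_length (by simp; omega)
    conv_rhs => rw [← ih (by omega), ← List.take_append_drop p (w.drop (n * p)), htake]
    simp [List.replicate_succ', List.drop_drop]

theorem isPower_iff_hasPeriod {w : List A} {β : ℚ} (hβ : 1 ≤ β) :
    IsPower w β ↔ ∃ p : ℕ, 0 < p ∧ β = w.length / p ∧ w.HasPeriod p := by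
  constructor
  · rintro ⟨x, x', n, hx, hx', rfl, rfl⟩
    have hlen : 0 < x.length := List.length_pos_of_ne_nil hx
    refine ⟨x.length, hlen, ?_, hasPeriod_of_isPrefix_append ?_⟩
    · simp only [List.length_append, List.length_flatten, List.map_replicate,
        List.sum_replicate_nat]
      push_cast
      field_simp
    · have hcomm : x ++ (List.replicate n x).flatten = (List.replicate n x).flatten ++ x := by
        rw [← List.flatten_cons, ← List.replicate_succ, List.replicate_succ', List.flatten_concat]
      rw [← List.append_assoc, hcomm, List.append_assoc, List.prefix_append_right_inj]
      exact hx'.trans (List.prefix_append _ _)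
  · rintro ⟨p, hp, rfl, hper⟩
    have hp' : (0 : ℚ) < p := by exact_mod_cast hp
    have hw : p ≤ w.length := by
      rw [one_le_div₀ hp'] at hβ
      exact_mod_cast hβ
    have htake : (w.take p).length = p := List.length_take_of_le hw
    have hdrop : (w.drop (w.length / p * p)).length = w.length % p := by
      rw [List.length_drop, Nat.mod_eq_sub_div_mul]
    refine ⟨w.take p, w.drop (w.length / p * p), w.length / p, ?_, ?_, ?_, ?_⟩
    · rwa [← List.length_pos_iff_ne_nil, htake]
    · refine List.prefix_of_prefix_length_le (isPrefix_drop_mul hper _) (List.take_prefix p w) ?_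
      rw [htake, hdrop]
      exact (Nat.mod_lt _ hp).le
    · exact (flatten_replicate_take_append_drop hper (Nat.div_mul_le_self _ _)).symm
    · rw [htake, hdrop, add_div' _ _ _ hp'.ne']
      exact_mod_cast congrArg (fun l : ℕ => (l : ℚ) / p) (Nat.div_add_mod' w.length p).symm

theorem length_subword (a : ℕ → A) (i m : ℕ) : (subword a i m).length = m := by
  simp [subword]

theorem hasPeriod_subword_iff {a : ℕ → A} {i m p : ℕ} :
    (subword a i m).HasPeriod p ↔ ∀ j, i ≤ j → j + p < i + m → a j = a (j + p) := by
  have hget : ∀ k < m, (subword a i m)[k]? = some (a (i + k)) := fun k hk => by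
    simp [subword, List.getElem?_range hk]
  rw [List.hasPeriod_iff_getElem?, length_subword]
  constructor
  · intro h j hij hj
    obtain ⟨k, rfl⟩ := Nat.exists_eq_add_of_le hij
    have hk := h k (by omega)
    rwa [hget k (by omega), hget (k + p) (by omega), Option.some_inj, ← add_assoc] at hk
  · intro h k hk
    rw [hget k (by omega), hget (k + p) (by omega), h (i + k) (by omega) (by omega), add_assoc]

theorem hasPeriod_subword_mono {a : ℕ → A} {i m j l p : ℕ} (hij : i ≤ j) (hjl : j + l ≤ i + m)
    (h : (subword a i m).HasPeriod p) : (subword a j l).HasPeriod p :=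
  hasPeriod_subword_iff.2 fun k hk hkl =>
    hasPeriod_subword_iff.1 h k (hij.trans hk) (hkl.trans_le hjl)

theorem hasSquareAt_of_isPower {a : ℕ → A} {i m : ℕ} {β : ℚ} (hβ : 2 ≤ β)
    (h : IsPower (subword a i m) β) : HasSquareAt a i := by
  obtain ⟨p, hp, rfl, hper⟩ := (isPower_iff_hasPeriod (one_le_two.trans hβ)).1 h
  have hp' : (0 : ℚ) < p := by exact_mod_cast hp
  rw [length_subword, le_div_iff₀ hp'] at hβ
  have hm : 2 * p ≤ m := by exact_mod_cast hβ
  refine ⟨2 * p, (isPower_iff_hasPeriod one_le_two).2 ⟨p, hp, ?_, ?_⟩⟩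
  · rw [length_subword, Nat.cast_mul, Nat.cast_two, mul_div_cancel_right₀ _ hp'.ne']
  · exact hasPeriod_subword_mono le_rfl (by omega) hper

theorem PowerFree.mono {a : ℕ → A} {α α' : ℝ} (h : PowerFree a α) (hα : α ≤ α') :
    PowerFree a α' :=
  fun β hβ => h β (hα.trans hβ)

end Periods

theorem apply_add_eq_add_nsmul {M : Type*} [AddMonoid M] {v : ℕ → M} {c : M} {i k : ℕ}
    (h : ∀ j, i ≤ j → j < i + k → v (j + 1) = v j + c) : v (i + k) = v i + k • c := by
  induction k with
  | zero => simp
  | succ k ih =>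
    rw [← add_assoc, h (i + k) (by omega) (by omega), ih fun j hij hj => h j hij (by omega),
      succ_nsmul, add_assoc]

/-- The Thue–Morse morphism `0 ↦ 01`, `1 ↦ 10` on infinite binary words: the image of a letter `x`
is `x` followed by its complement `x + 1`. -/
def thueMorse (u : ℕ → Fin 2) (n : ℕ) : Fin 2 :=
  u (n / 2) + if Even n then 0 else 1

theorem thueMorse_two_mul (u : ℕ → Fin 2) (n : ℕ) : thueMorse u (2 * n) = u n := by
  simp [thueMorse]

theorem thueMorse_two_mul_add_one (u : ℕ → Fin 2) (n : ℕ) :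
    thueMorse u (2 * n + 1) = u n + 1 := by
  have hdiv : (2 * n + 1) / 2 = n := by omega
  simp [thueMorse, hdiv]

theorem thueMorse_succ_of_even (u : ℕ → Fin 2) {j : ℕ} (hj : Even j) :
    thueMorse u (j + 1) = thueMorse u j + 1 := by
  obtain ⟨n, rfl⟩ := hj.two_dvd
  rw [thueMorse_two_mul_add_one, thueMorse_two_mul]

theorem thueMorse_succ_ne_of_even (u : ℕ → Fin 2) {j : ℕ} (hj : Even j) :
    thueMorse u (j + 1) ≠ thueMorse u j := by
  simp [thueMorse_succ_of_even u hj]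

theorem iterate_thueMorse_apply (s : ℕ) (u : ℕ → Fin 2) (n : ℕ) :
    thueMorse^[s] u n = u (n / 2 ^ s) + thueMorse^[s] 0 n := by
  induction s generalizing n with
  | zero => simp
  | succ s ih =>
    rw [Function.iterate_succ_apply', Function.iterate_succ_apply', thueMorse, ih, thueMorse,
      Nat.div_div_eq_div_mul, ← pow_succ', add_assoc]

theorem iterate_thueMorse_apply_zero (s : ℕ) (u : ℕ → Fin 2) : thueMorse^[s] u 0 = u 0 := by
  induction s with
  | zero => rfl
  | succ s ih => rw [Function.iterate_succ_apply', ← ih]; exact thueMorse_two_mul _ 0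

theorem iterate_thueMorse_two_mul_apply_last (k : ℕ) (u : ℕ → Fin 2) :
    thueMorse^[2 * k] u (2 ^ (2 * k) - 1) = u 0 := by
  induction k with
  | zero => rfl
  | succ k ih =>
    have hlast : 2 ^ (2 * (k + 1)) - 1 = 2 * (2 * (2 ^ (2 * k) - 1) + 1) + 1 := by
      have := Nat.one_le_two_pow (n := 2 * k)
      rw [mul_add_one, pow_add]
      omega
    have hcompl : ∀ x : Fin 2, x + 1 + 1 = x := by decide
    rw [hlast, mul_add_one, Function.iterate_succ_apply', thueMorse_two_mul_add_one,
      Function.iterate_succ_apply', thueMorse_two_mul_add_one, ih, hcompl]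

theorem hasPeriod_subword_thueMorse {u : ℕ → Fin 2} {i m p : ℕ}
    (h : (subword u i m).HasPeriod p) :
    (subword (thueMorse u) (2 * i) (2 * m)).HasPeriod (2 * p) := by
  rw [hasPeriod_subword_iff] at h ⊢
  intro j hij hj
  have heven : Even (j + 2 * p) ↔ Even j := by simp [Nat.even_add]
  simp only [thueMorse, heven, Nat.add_mul_div_left _ _ two_pos,
    h (j / 2) (by omega) (by omega)]

theorem hasPeriod_subword_iterate_thueMorse {u : ℕ → Fin 2} {i m p : ℕ}
    (h : (subword u i m).HasPeriod p) (s : ℕ) :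
    (subword (thueMorse^[s] u) (2 ^ s * i) (2 ^ s * m)).HasPeriod (2 ^ s * p) := by
  induction s with
  | zero => simpa using h
  | succ s ih =>
    rw [Function.iterate_succ_apply']
    simpa only [pow_succ', mul_assoc] using hasPeriod_subword_thueMorse ih

theorem hasPeriod_subword_of_thueMorse {u : ℕ → Fin 2} {i m q : ℕ} (hq : 2 * q < m)
    (h : (subword (thueMorse u) i m).HasPeriod (2 * q)) :
    (subword u (i / 2) ((m + i % 2 + 1) / 2)).HasPeriod q := by
  rw [hasPeriod_subword_iff] at h ⊢
  intro j hij hj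
  rcases le_or_gt i (2 * j) with hi | hi
  · have heq := h (2 * j) hi (by omega)
    rwa [← mul_add, thueMorse_two_mul, thueMorse_two_mul] at heq
  · have heq := h (2 * j + 1) (by omega) (by omega)
    rw [add_right_comm, ← mul_add, thueMorse_two_mul_add_one, thueMorse_two_mul_add_one] at heq
    exact add_right_cancel heq

theorem even_of_overlap_thueMorse {u : ℕ → Fin 2} {i m p : ℕ} (hm : 2 * p < m)
    (h : (subword (thueMorse u) i m).HasPeriod p) : Even p := by
  rw [hasPeriod_subword_iff] at h
  by_contra hp
  rw [Nat.not_even_iff_odd] at hp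
  -- An odd shift by `p` turns a pair of letters straddling two blocks into a block.
  have halt : ∀ j, i ≤ j → j < i + p → thueMorse u (j + 1) = thueMorse u j + 1 := by
    intro j hij hj
    rcases Nat.even_or_odd j with hj_even | hj_odd
    · exact thueMorse_succ_of_even u hj_even
    · rw [h j hij (by omega), h (j + 1) (by omega) (by omega), add_right_comm]
      exact thueMorse_succ_of_even u (hj_odd.add_odd hp)
  have hodd : p • (1 : Fin 2) = 1 := by
    obtain ⟨q, rfl⟩ := hp
    have htwo : 2 • (1 : Fin 2) = 0 := rfl
    rw [succ_nsmul, mul_nsmul, htwo, nsmul_zero, zero_add]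
  have hshift := apply_add_eq_add_nsmul halt
  rw [← h i le_rfl (by omega), hodd] at hshift
  simp at hshift

theorem exists_hasPeriod_of_overlap_iterate_thueMorse {u : ℕ → Fin 2} (s : ℕ) {i m p : ℕ}
    (hm : 2 * p < m) (h : (subword (thueMorse^[s] u) i m).HasPeriod p) :
    ∃ i' m' q, p = 2 ^ s * q ∧ m ≤ 2 ^ s * m' ∧ (subword u i' m').HasPeriod q := by
  induction s generalizing i m p with
  | zero => exact ⟨i, m, p, by simp, by simp, h⟩
  | succ s ih =>
    rw [Function.iterate_succ_apply'] at h
    obtain ⟨r, rfl⟩ := (even_of_overlap_thueMorse hm h).two_dvd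
    obtain ⟨i', m', q, rfl, hm', hper⟩ :=
      ih (by omega) (hasPeriod_subword_of_thueMorse (by omega) h)
    refine ⟨i', m', q, by ring, ?_, hper⟩
    rw [pow_succ', mul_assoc]
    omega

theorem even_of_square_prefix_thueMorse_thueMorse {u : ℕ → Fin 2} {p : ℕ}
    (h : (subword (thueMorse (thueMorse u)) 0 (2 * p)).HasPeriod p) : Even p := by
  rw [hasPeriod_subword_iff] at h
  by_contra hp
  rw [Nat.not_even_iff_odd] at hp
  obtain rfl | hp3 : p = 1 ∨ 3 ≤ p := by
    obtain ⟨q, rfl⟩ := hp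
    omega
  · exact thueMorse_succ_ne_of_even _ Even.zero (h 0 le_rfl (by omega)).symm
  · -- The images of letters under `μ²` are `0110` and `1001`.
    have hmiddle : thueMorse (thueMorse u) 2 = thueMorse (thueMorse u) 1 := by
      simp [thueMorse]
    rw [h 1 (by omega) (by omega), h 2 (by omega) (by omega), add_right_comm 1 1 p] at hmiddle
    exact thueMorse_succ_ne_of_even _ (odd_one.add_odd hp) hmiddle

theorem two_pow_le_of_square_prefix_iterate_thueMorse (k : ℕ) {u : ℕ → Fin 2} {p : ℕ}
    (hp : 0 < p) (h : (subword (thueMorse^[k + 1] u) 0 (2 * p)).HasPeriod p) : 2 ^ k ≤ p := by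
  induction k generalizing p with
  | zero => exact hp
  | succ k ih =>
    have heven : Even p := even_of_square_prefix_thueMorse_thueMorse (u := thueMorse^[k] u) <| by
      simpa only [Function.iterate_succ_apply'] using h
    obtain ⟨q, rfl⟩ := heven.two_dvd
    rw [Function.iterate_succ_apply'] at h
    have hq := ih (by omega) <|
      hasPeriod_subword_mono le_rfl (by omega) (hasPeriod_subword_of_thueMorse (by omega) h)
    rw [pow_succ']
    omega

/-- The infinite word `w` starting with `0` such that `w = 0 μˢ(w)`, where `μ` is the Thue–Morse
morphism. The recursion spells out the letters of `μˢ(w)` by `iterate_thueMorse_apply`. -/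
def overlapWord (s : ℕ) : ℕ → Fin 2
  | 0 => 0
  | n + 1 => overlapWord s (n / 2 ^ s) + thueMorse^[s] 0 n
termination_by n => n
decreasing_by exact Nat.lt_succ_of_le (Nat.div_le_self _ _)

theorem overlapWord_succ (s n : ℕ) :
    overlapWord s (n + 1) = thueMorse^[s] (overlapWord s) n := by
  rw [overlapWord, ← iterate_thueMorse_apply]

theorem subword_overlapWord_succ (s i m : ℕ) :
    subword (overlapWord s) (i + 1) m = subword (thueMorse^[s] (overlapWord s)) i m := by
  simp only [subword, add_right_comm i 1, overlapWord_succ]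

theorem hasPeriod_subword_overlapWord_zero (k : ℕ) :
    (subword (overlapWord (2 * k)) 0 (2 * 2 ^ (2 * k) + 1)).HasPeriod (2 ^ (2 * k)) := by
  have hstart : (subword (overlapWord (2 * k)) 0 2).HasPeriod 1 := by
    refine hasPeriod_subword_iff.2 fun j _ hj => ?_
    obtain rfl : j = 0 := by omega
    rw [overlapWord_succ, iterate_thueMorse_apply_zero]
  have htail := hasPeriod_subword_iterate_thueMorse hstart (2 * k)
  rw [mul_zero, mul_one, ← subword_overlapWord_succ, hasPeriod_subword_iff] at htail
  refine hasPeriod_subword_iff.2 fun j _ hj => ?_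
  rcases j.eq_zero_or_pos with rfl | hj_pos
  · have hlast := overlapWord_succ (2 * k) (2 ^ (2 * k) - 1)
    rw [Nat.sub_add_cancel Nat.one_le_two_pow, iterate_thueMorse_two_mul_apply_last] at hlast
    rw [zero_add, hlast]
  · exact htail j hj_pos (by omega)

theorem exists_overlap_overlapWord (k i : ℕ) :
    ∃ p, 0 < p ∧ (subword (overlapWord (2 * k)) i (2 * p + 1)).HasPeriod p := by
  induction i using Nat.strong_induction_on with
  | _ i ih =>
    rcases i with _ | n
    · exact ⟨2 ^ (2 * k), by positivity, hasPeriod_subword_overlapWord_zero k⟩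
    · obtain ⟨p, hp, hper⟩ := ih (n / 2 ^ (2 * k)) (Nat.lt_succ_of_le (Nat.div_le_self _ _))
      refine ⟨2 ^ (2 * k) * p, by positivity, ?_⟩
      rw [subword_overlapWord_succ]
      refine hasPeriod_subword_mono (Nat.mul_div_le _ _) ?_
        (hasPeriod_subword_iterate_thueMorse hper (2 * k))
      have hdiv := Nat.div_add_mod n (2 ^ (2 * k))
      have hmod := Nat.mod_lt n (Nat.two_pow_pos (2 * k))
      linarith

theorem length_add_two_pow_le_of_iterate_thueMorse {u : ℕ → Fin 2} {s i m p : ℕ} {c : ℝ}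
    (hm : 2 * p < m) (h : (subword (thueMorse^[s] u) i m).HasPeriod p)
    (hu : ∀ i' m' q, 2 ^ s * q = p → 2 * q < m' → (subword u i' m').HasPeriod q →
      (m' : ℝ) + 1 ≤ c * q) :
    (m : ℝ) + 2 ^ s ≤ c * p := by
  obtain ⟨i', m', q, rfl, hm', hper⟩ := exists_hasPeriod_of_overlap_iterate_thueMorse s hm h
  have hq : 2 * q < m' := lt_of_mul_lt_mul_left (a := 2 ^ s) (by linarith) (Nat.zero_le _)
  calc (m : ℝ) + 2 ^ s ≤ 2 ^ s * m' + 2 ^ s := by gcongr; exact_mod_cast hm'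
    _ = 2 ^ s * (m' + 1) := by ring
    _ ≤ 2 ^ s * (c * q) := by gcongr; exact hu i' m' q rfl hq hper
    _ = c * (2 ^ s * q : ℕ) := by push_cast; ring

theorem overlapWord_overlap_length_add_one_le {s : ℕ} (hs : s ≠ 0) {i m p : ℕ} (hp : 0 < p)
    (hm : 2 * p < m) (h : (subword (overlapWord s) i m).HasPeriod p) :
    (m : ℝ) + 1 ≤ (2 + 4 / 2 ^ s) * p := by
  obtain ⟨k, rfl⟩ := Nat.exists_eq_add_one_of_ne_zero hs
  induction p using Nat.strong_induction_on generalizing i m with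
  | _ p ih =>
    have htwo : (2 : ℝ) ≤ 2 ^ (k + 1) := by exact_mod_cast Nat.le_self_pow hs 2
    have hdescend {i₁ m₁ : ℕ} (hm₁ : 2 * p < m₁)
        (h₁ : (subword (thueMorse^[k + 1] (overlapWord (k + 1))) i₁ m₁).HasPeriod p) :
        (m₁ : ℝ) + 2 ^ (k + 1) ≤ (2 + 4 / 2 ^ (k + 1)) * p := by
      refine length_add_two_pow_le_of_iterate_thueMorse hm₁ h₁ ?_
      rintro i' m' q rfl hm' hper
      have hq : 0 < q := Nat.pos_of_mul_pos_left hp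
      exact ih q (lt_mul_of_one_lt_left hq (Nat.one_lt_two_pow hs)) hq hm' hper
    rcases i with _ | i
    · obtain ⟨m, rfl⟩ := Nat.exists_eq_add_one.2 (Nat.zero_lt_of_lt hm)
      have htail : (subword (thueMorse^[k + 1] (overlapWord (k + 1))) 0 m).HasPeriod p := by
        rw [← subword_overlapWord_succ]
        exact hasPeriod_subword_mono (Nat.zero_le _) (by omega) h
      rcases (Nat.le_of_lt_succ hm).lt_or_eq with hm' | rfl
      · have := hdescend hm' htail
        push_cast
        linarith
      · have hk : (2 : ℝ) ^ k ≤ p := by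
          exact_mod_cast two_pow_le_of_square_prefix_iterate_thueMorse k hp htail
        have hexcess : (2 : ℝ) ≤ 4 / 2 ^ (k + 1) * p := by
          rw [div_mul_eq_mul_div, le_div_iff₀ (by positivity), pow_succ]
          linarith
        push_cast
        linarith
    · rw [subword_overlapWord_succ] at h
      linarith [hdescend hm h]

theorem powerFree_overlapWord {s : ℕ} (hs : s ≠ 0) :
    PowerFree (overlapWord s) (2 + 4 / 2 ^ s) := by
  intro β hβ i m hpow
  have hβ_two : (2 : ℝ) < β := lt_of_lt_of_le (lt_add_of_pos_right 2 (by positivity)) hβ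
  have hβ_one : (1 : ℚ) ≤ β := by
    have : (1 : ℝ) ≤ β := by linarith
    exact_mod_cast this
  obtain ⟨p, hp, rfl, hper⟩ := (isPower_iff_hasPeriod hβ_one).1 hpow
  have hp' : (0 : ℝ) < p := by exact_mod_cast hp
  rw [length_subword] at hβ hβ_two
  push_cast at hβ hβ_two
  rw [lt_div_iff₀ hp'] at hβ_two
  rw [le_div_iff₀ hp'] at hβ
  have := overlapWord_overlap_length_add_one_le hs hp (by exact_mod_cast hβ_two) hper
  linarith

end InfWord

theorem mainTheorem5_general (α : ℝ) (hα : 2 < α) :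
    ∃ a : ℕ → Fin 2, InfWord.PowerFree a α ∧
      ∀ i : ℕ, ∃ (m : ℕ) (β : ℚ), 2 < β ∧ InfWord.IsPower (InfWord.subword a i m) β := by
  obtain ⟨k, hk⟩ : ∃ k : ℕ, 4 / 2 ^ (2 * (k + 1)) < α - 2 := by
    obtain ⟨k, hk⟩ := exists_pow_lt_of_lt_one (sub_pos.2 hα) (y := (1 / 4 : ℝ)) (by norm_num)
    have hpow : (4 : ℝ) / 2 ^ (2 * (k + 1)) = (1 / 4) ^ k := by
      have htwo_sq : (2 : ℝ) ^ 2 = 4 := by norm_num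
      rw [pow_mul, htwo_sq, pow_succ, one_div_pow]
      field_simp
    exact ⟨k, hpow.trans_lt hk⟩
  refine ⟨InfWord.overlapWord (2 * (k + 1)),
    (InfWord.powerFree_overlapWord (by omega)).mono (by linarith), fun i => ?_⟩
  obtain ⟨p, hp, hper⟩ := InfWord.exists_overlap_overlapWord (k + 1) i
  have hβ : (2 : ℚ) < (2 * p + 1 : ℕ) / p := by
    rw [lt_div_iff₀ (by exact_mod_cast hp)]
    exact_mod_cast Nat.lt_succ_self (2 * p)
  refine ⟨2 * p + 1, _, hβ, (InfWord.isPower_iff_hasPeriod (by linarith)).2 ⟨p, hp, ?_, hper⟩⟩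
  rw [InfWord.length_subword]

theorem mainTheorem5 (α : ℝ) (hα : 2 < α) :
    ∃ a : ℕ → Fin 2, InfWord.PowerFree a α ∧ ∀ i : ℕ, InfWord.HasSquareAt a i := by
  obtain ⟨a, hfree, hoverlap⟩ := mainTheorem5_general α hα
  exact ⟨a, hfree, fun i =>
    let ⟨_, _, hβ, hpow⟩ := hoverlap i; InfWord.hasSquareAt_of_isPower hβ.le hpow⟩
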